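/- Consider the five mirror pairs of bimodal singularities $(B',B)$ equal to $(Z_{13},J_{3,0})$, $(X_{2,0},S_{17})$, $(W_{18},W_{18})$, $(W_{17},S_{1,0})$, $(U_{16},U_{16})$, and let $f\in\mathbb{C}[x,y,z]$ be the defining equation of $B$, that is, respectively, $f=x^6+xy^3+z^2$, $\;x^6y+y^2z+z^2$, $\;x^7+y^2z+z^2$, $\;x^5y+y^2z+z^2$, $\;x^5+y^2z+yz^2$. A polynomial $F=\sum_i\prod_j x_j^{a_{ij}}$ with as many monomials as variables is *invertible* if the matrix $A=(a_{ij})$ of nonnegative integers is invertible, $F$ is weighted homogeneous for some positive integer weights $q_j$, and $F$ has exactly one critical point, the origin. An *invertible deformation* of $f$ is an invertible polynomial $F(w,x,y,z)=f(x,y,z)+\text{(one monomial involving }w)$. Suppose that its weights satisfy the Calabi–Yau condition $\deg F=\sum_j q_j$, and let $M$ be a lattice of rank three in $\{m\in\mathbb{Z}^4:\sum_j q_jm_j=0\}$ (for instance this whole lattice) that contains $m-(1,1,1,1)$ for every exponent vector $m$ of $F$. The *Newton polytope* $\Delta\subset M\otimes\mathbb{R}$ of $F$ is the convex hull of these points $m-(1,1,1,1)$.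 With $N=\mathrm{Hom}(M,\mathbb{Z})$, the lattice polytope $\Delta$ is *reflexive* if it has the origin in its interior and its polar dual $\Delta^\circ=\{v\in N\otimes\mathbb{R}:\langle v,u\rangle\ge-1\text{ for all }u\in\Delta\}$ is a lattice polytope as well. For a three-dimensional reflexive polytope $\Delta$, let $\mathrm{Pic}_\Delta$ be the group of divisor classes on a general anticanonical K3 hypersurface $X$, in the smooth toric variety $\mathbb{P}_\Delta$ of a maximal projective subdivision of the normal fan of $\Delta$, that is generated by all irreducible components of the intersections of $X$ with the toric divisors. Explicitly, $\mathrm{Pic}_\Delta$ is the free abelian group on the following components: one component $D_v$ for each vertex $v$ of $\Delta^\circ$, and $\ell^*(\Gamma)+1$ components $D_v^{(k)}$ for each lattice point $v$ in the relative interior of an edge $\Gamma^\circ$ of $\Delta^\circ$, where $\Gamma$ is the dual edge of $\Delta$ and $\ell^*(\Gamma)$ is the number of lattice points in its relative interior; modulo the relations $\sum_{v,k}\langle v,m\rangle D_v^{(k)}=0$ for $m\in M$. Then, for each of the five pairs, there is no such $F$ and $M$ for which $\Delta$ is reflexive and $$\operatorname{rank}\mathrm{Pic}_\Delta+\operatorname{rank}\mathrm{Pic}_{\Delta^\circ}=20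 .$$ -/

import Mathlib

open MvPolynomial

/-! ### Invertible polynomials and the five bimodal singularities -/

/-- The polynomial `F_A = ∑ i, ∏ j, x_j ^ (a_ij)` of a square matrix of nonnegative integers. -/
noncomputable def matrixPolynomial {n : ℕ} (A : Matrix (Fin n) (Fin n) ℕ) :
    MvPolynomial (Fin n) ℂ :=
  ∑ i, ∏ j, (X j : MvPolynomial (Fin n) ℂ) ^ A i j

/-- `F` is invertible: `F = F_A` for an invertible matrix `A` of nonnegative integers, `F` is
weighted homogeneous for some positive integer weights, and the origin is its one and only
critical point in `ℂⁿ`. -/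
def IsInvertiblePolynomial {n : ℕ} (F : MvPolynomial (Fin n) ℂ) : Prop :=
  ∃ A : Matrix (Fin n) (Fin n) ℕ,
    F = matrixPolynomial A ∧
    (A.map (fun a : ℕ => (a : ℚ))).det ≠ 0 ∧
    (∃ (q : Fin n → ℕ) (d : ℕ), (∀ j, 0 < q j) ∧ ∀ i, ∑ j, q j * A i j = d) ∧
    {p : Fin n → ℂ | ∀ j, eval p (pderiv j F) = 0} = {0}

/-- The five mirror pairs `(B', B)` of bimodal singularities
`(Z₁₃, J₃,₀)`, `(X₂,₀, S₁₇)`, `(W₁₈, W₁₈)`, `(W₁₇, S₁,₀)`, `(U₁₆, U₁₆)`. -/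
inductive BimodalPair : Type
  | Z13_J30
  | X20_S17
  | W18_W18
  | W17_S10
  | U16_U16

/-- The defining equation `f` of the second member `B` of the pair `(B', B)`, in the variables
`x = X 0`, `y = X 1`, `z = X 2`. -/
noncomputable def BimodalPair.definingEquation : BimodalPair → MvPolynomial (Fin 3) ℂ
  | .Z13_J30 => X 0 ^ 6 + X 0 * X 1 ^ 3 + X 2 ^ 2
  | .X20_S17 => X 0 ^ 6 * X 1 + X 1 ^ 2 * X 2 + X 2 ^ 2
  | .W18_W18 => X 0 ^ 7 + X 1 ^ 2 * X 2 + X 2 ^ 2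
  | .W17_S10 => X 0 ^ 5 * X 1 + X 1 ^ 2 * X 2 + X 2 ^ 2
  | .U16_U16 => X 0 ^ 5 + X 1 ^ 2 * X 2 + X 1 * X 2 ^ 2

/-- `F`, a polynomial in `w = X 0`, `x = X 1`, `y = X 2`, `z = X 3`, is an invertible deformation
of `f(x, y, z)`: it is an invertible polynomial obtained from `f` by adding one monomial that
involves the new variable `w`. -/
def IsInvertibleDeformation (F : MvPolynomial (Fin 4) ℂ) (f : MvPolynomial (Fin 3) ℂ) : Prop :=
  IsInvertiblePolynomial F ∧
    ∃ e : Fin 4 →₀ ℕ, 0 < e 0 ∧ F = rename Fin.succ f + monomial e 1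

/-- `q` is a system of positive integer weights for which `F` is weighted homogeneous of degree
`∑ q_j` (the Calabi-Yau condition: `F` is an anticanonical member of the weighted projective
space with weights `q`). -/
def IsCalabiYauWeight (F : MvPolynomial (Fin 4) ℂ) (q : Fin 4 → ℕ) : Prop :=
  (∀ j, 0 < q j) ∧ ∀ m ∈ F.support, ∑ j, q j * m j = ∑ j, q j

/-- `b` is a ℤ-basis of a three-dimensional lattice `M` contained in the weight lattice
`{m ∈ ℤ⁴ | ∑ q_j m_j = 0}` and containing `m - (1,1,1,1)` for every exponent `m` of `F`. -/
def IsExponentLatticeBasis (F : MvPolynomial (Fin 4) ℂ) (q : Fin 4 → ℕ)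
    (b : Fin 3 → Fin 4 → ℤ) : Prop :=
  LinearIndependent ℤ b ∧
    (∀ i, ∑ j, (q j : ℤ) * b i j = 0) ∧
    ∀ m ∈ F.support, (fun j => (m j : ℤ) - 1) ∈ Submodule.span ℤ (Set.range b)

/-! ### Lattice polytopes in `ℝ³`, with the lattice `ℤ³` and the standard pairing -/

/-- The inclusion of `ℤ³` in `ℝ³`. -/
def latticeIncl (k : Fin 3 → ℤ) : Fin 3 → ℝ := fun i => (k i : ℝ)

/-- The Newton polytope of `F` in the coordinates given by the lattice basis `b`: the convex hull
of the lattice points that correspond to the monomials of `F`, where the monomial with exponent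
`m` corresponds to the coordinate vector of `m - (1,1,1,1)`. -/
def newtonPolytope (F : MvPolynomial (Fin 4) ℂ) (b : Fin 3 → Fin 4 → ℤ) : Set (Fin 3 → ℝ) :=
  convexHull ℝ (latticeIncl ''
    {k : Fin 3 → ℤ | ∃ m ∈ F.support, ∀ j, ∑ i, k i * b i j = (m j : ℤ) - 1})

/-- A lattice polytope: the convex hull of finitely many lattice points. -/
def IsLatticePolytope (P : Set (Fin 3 → ℝ)) : Prop :=
  ∃ S : Set (Fin 3 → ℤ), S.Finite ∧ P = convexHull ℝ (latticeIncl '' S)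

/-- The polar dual `{v | ⟨v, w⟩ ≥ -1 for all w ∈ P}`. -/
def polarDual (P : Set (Fin 3 → ℝ)) : Set (Fin 3 → ℝ) :=
  {v | ∀ w ∈ P, -1 ≤ v ⬝ᵥ w}

/-- A reflexive polytope: a lattice polytope with the origin in its interior whose polar dual is
also a lattice polytope. -/
def IsReflexive (P : Set (Fin 3 → ℝ)) : Prop :=
  IsLatticePolytope P ∧ 0 ∈ interior P ∧ IsLatticePolytope (polarDual P)

/-- `G` is an edge (a one-dimensional face) of the polytope `P`. -/
def IsEdge (P G : Set (Fin 3 → ℝ)) : Prop :=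
  IsExposed ℝ P G ∧ Module.finrank ℝ (vectorSpan ℝ G) = 1

/-- `ℓ*(G)`: the number of lattice points in the relative interior of `G`. -/
noncomputable def interiorLatticeCount (G : Set (Fin 3 → ℝ)) : ℕ :=
  {k : Fin 3 → ℤ | latticeIncl k ∈ intrinsicInterior ℝ G}.ncard

/-- The face of `Δ` that is dual to the face `G` of `Δ°`. -/
def dualFace (Δ G : Set (Fin 3 → ℝ)) : Set (Fin 3 → ℝ) :=
  {w ∈ Δ | ∀ v ∈ G, v ⬝ᵥ w = -1}

/-! ### The lattice `Pic_Δ` -/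

/-- The irreducible components of the curves cut out on a general anticanonical K3 hypersurface
`X` of the smooth toric variety `ℙ_Δ` by its toric divisors `D_v`, where `v` runs through the
nonzero lattice points of `Δ°`:
* if `v` is a vertex of `Δ°`, then `X ∩ D_v` is irreducible: one component `(v, 0)`;
* if `v` lies in the relative interior of an edge `Γ°` of `Δ°`, then `X ∩ D_v` is the disjoint
  union of `ℓ*(Γ) + 1` rational curves, `Γ` being the dual edge of `Δ`:
  components `(v, 0), …, (v, ℓ*(Γ))`;
* if `v` lies in the relative interior of a facet of `Δ°`, then `X ∩ D_v` is empty. -/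
def divisorComponents (Δ : Set (Fin 3 → ℝ)) : Set ((Fin 3 → ℤ) × ℕ) :=
  {c | (latticeIncl c.1 ∈ (polarDual Δ).extremePoints ℝ ∧ c.2 = 0) ∨
    ∃ G, IsEdge (polarDual Δ) G ∧ latticeIncl c.1 ∈ intrinsicInterior ℝ G ∧
      c.2 ≤ interiorLatticeCount (dualFace Δ G)}

/-- The divisor on `X` of the character `m ∈ M = ℤ³` of the torus: it has multiplicity `⟨m, v⟩`
along every component of `X ∩ D_v`. -/
def characterDivisor (Δ : Set (Fin 3 → ℝ)) :
    (Fin 3 → ℤ) →ₗ[ℤ] (divisorComponents Δ → ℤ) where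
  toFun m := fun c => m ⬝ᵥ c.1.1
  map_add' m m' := by
    funext c
    exact add_dotProduct m m' c.1.1
  map_smul' a m := by
    funext c
    exact smul_dotProduct a m c.1.1

/-- `Pic_Δ`: the group of divisor classes on `X` that is generated by all components of the
intersections of `X` with the toric divisors of `ℙ_Δ`, that is, the free abelian group on these
components modulo the divisors of characters. -/
abbrev PicLattice (Δ : Set (Fin 3 → ℝ)) : Type :=
  (divisorComponents Δ → ℤ) ⧸ LinearMap.range (characterDivisor Δ)

/-- The rank of `Pic_Δ`. -/
noncomputable def rankPic (Δ : Set (Fin 3 → ℝ)) : ℕ :=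
  Module.finrank ℤ (PicLattice Δ)

/-! ### Pairs of dual reflexive simplices -/

/-! The equation `f` and the Calabi–Yau condition determine the weights up to scale. The origin can
be the only critical point only if the new monomial is `w ^ a` or `w ^ a * x_j`; otherwise the whole
`w`-axis is critical. The weights then fix `a`, so each family has at most four candidates. Of the
twenty in all, five need a non-integral `a`, and six have a critical point off the origin, because
two monomials are linear in the same variable.

For the rest, `Δ` is a simplex with vertices `k i`, and there are positive integers `w i` with `∑ w
i • k i = 0`. The vertex of the polar dual opposite to `k j` pairs to `-1` with the other vertices
and to `(∑ w) / w j - 1` with `k j`. Hence reflexivity forces `w j ∣ ∑ w`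
(`IsAdmissible.dvd_sum_weights`), which removes six more candidates.

Three reflexive simplices remain, and there the ranks are too large. The character relations lower
the number of components by at most 3. An edge of `Δ°` of lattice length `h`, whose dual edge has
length `g`, carries `(h - 1) * g` components, so with the four vertices the rank is at least `1 + ∑
(h - 1) * g` (`IsDualPair.le_rankPic`). Applied to `Δ` and `Δ°`, the bounds add up to 22, 21 and 22.
The lattice `M` is not fixed, so the `h` and `g` used are divisors of edge lengths valid for every
`M`: they are certified by integral combinations of vectors that must lie in `M` or `N`, namely the
vertices and the coordinate functionals. -/

theorem latticeIncl_dotProduct (a b : Fin 3 → ℤ) :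
    latticeIncl a ⬝ᵥ latticeIncl b = ((a ⬝ᵥ b : ℤ) : ℝ) := by
  simp [latticeIncl, dotProduct]

theorem latticeIncl_injective : Function.Injective latticeIncl := by
  intro a b h
  funext i
  have := congrFun h i
  simpa [latticeIncl] using this

/-- `k` and `n` are the vertices of two simplices that are polar dual to each other: the vertex
`n j` is dual to the facet opposite to `k j`. -/
structure IsDualPair (k n : Fin 4 → Fin 3 → ℤ) (c : Fin 4 → ℤ) : Prop where
  pos : ∀ j, 0 < c j
  pairing : ∀ i j, n j ⬝ᵥ k i = (if i = j then c j else 0) - 1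
  sum_inv : ∑ j, (c j : ℝ)⁻¹ = 1

/-- The lattice simplex with vertices `k`. -/
def latticeSimplex (k : Fin 4 → Fin 3 → ℤ) : Set (Fin 3 → ℝ) :=
  convexHull ℝ (Set.range fun i => latticeIncl (k i))

theorem latticeIncl_mem_latticeSimplex (k : Fin 4 → Fin 3 → ℤ) (i : Fin 4) :
    latticeIncl (k i) ∈ latticeSimplex k :=
  subset_convexHull ℝ _ ⟨i, rfl⟩

theorem convex_dotProduct_ge (v : Fin 3 → ℝ) (r : ℝ) : Convex ℝ {w | r ≤ v ⬝ᵥ w} :=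
  convex_halfSpace_ge ⟨fun x y => dotProduct_add v x y, fun a x => dotProduct_smul a v x⟩ r

theorem mem_polarDual_latticeSimplex {k : Fin 4 → Fin 3 → ℤ} {v : Fin 3 → ℝ} :
    v ∈ polarDual (latticeSimplex k) ↔ ∀ i, -1 ≤ v ⬝ᵥ latticeIncl (k i) := by
  refine ⟨fun h i => h _ (latticeIncl_mem_latticeSimplex k i), fun h w hw => ?_⟩
  refine convexHull_min ?_ (convex_dotProduct_ge v (-1)) hw
  rintro _ ⟨i, rfl⟩
  exact h i

/-! ### Barycentric coordinates and polarity for a dual pair of simplices. -/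

namespace IsDualPair

variable {k n : Fin 4 → Fin 3 → ℤ} {c : Fin 4 → ℤ}

theorem symm (D : IsDualPair k n c) : IsDualPair n k c where
  pos := D.pos
  pairing i j := by
    rw [dotProduct_comm, D.pairing]
    by_cases h : i = j
    · simp [h]
    · simp [h, Ne.symm h]
  sum_inv := D.sum_inv

theorem cast_pos (D : IsDualPair k n c) (j : Fin 4) : (0 : ℝ) < c j := by
  exact_mod_cast D.pos j

theorem pairing_real (D : IsDualPair k n c) (i j : Fin 4) :
    latticeIncl (n j) ⬝ᵥ latticeIncl (k i) = (if i = j then (c j : ℝ) else 0) - 1 := by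
  rw [latticeIncl_dotProduct, D.pairing]
  push_cast
  rfl

/-- Omitting index 0, the pairing matrix is a diagonal matrix minus the all-ones matrix. Its
determinant is `c 1 * c 2 * c 3 * (1 - 1/c 1 - 1/c 2 - 1/c 3)`, which by `sum_inv` is `c 1 * c 2 * c
3 / c 0 > 0`; so three of the `k i` already span. -/
theorem eq_zero_of_forall_dotProduct (D : IsDualPair k n c) {v : Fin 3 → ℝ}
    (hv : ∀ i, v ⬝ᵥ latticeIncl (k i) = 0) : v = 0 := by
  let K : Matrix (Fin 3) (Fin 3) ℝ := Matrix.of fun a => latticeIncl (k a.succ)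
  let N : Matrix (Fin 3) (Fin 3) ℝ := Matrix.of fun a => latticeIncl (n a.succ)
  have hG : N * K.transpose =
      Matrix.of fun a b : Fin 3 => (if b.succ = a.succ then (c a.succ : ℝ) else 0) - 1 := by
    ext a b
    simp only [Matrix.mul_apply', Matrix.of_apply]
    exact D.pairing_real b.succ a.succ
  have hdet : (N * K.transpose).det = (c 1 : ℝ) * c 2 * c 3 * (c 0 : ℝ)⁻¹ := by
    have h0 := D.cast_pos 0
    have h1 := D.cast_pos 1
    have h2 := D.cast_pos 2
    have h3 := D.cast_pos 3
    have hs := D.sum_inv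
    rw [Fin.sum_univ_four] at hs
    have h0' : (c 0 : ℝ)⁻¹ = 1 - (c 1 : ℝ)⁻¹ - (c 2 : ℝ)⁻¹ - (c 3 : ℝ)⁻¹ := by linarith
    rw [h0', hG, Matrix.det_fin_three]
    simp
    field_simp
    ring
  have hne : K.det ≠ 0 := by
    intro h
    rw [Matrix.det_mul, Matrix.det_transpose, h, mul_zero] at hdet
    have := mul_pos (mul_pos (mul_pos (D.cast_pos 1) (D.cast_pos 2)) (D.cast_pos 3))
      (inv_pos.mpr (D.cast_pos 0))
    exact this.ne hdet
  refine Matrix.eq_zero_of_mulVec_eq_zero hne ?_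
  funext a
  have := hv a.succ
  rw [dotProduct_comm] at this
  exact this

theorem eq_of_forall_dotProduct (D : IsDualPair k n c) {v w : Fin 3 → ℝ}
    (h : ∀ i, v ⬝ᵥ latticeIncl (k i) = w ⬝ᵥ latticeIncl (k i)) : v = w := by
  rw [← sub_eq_zero]
  refine D.eq_zero_of_forall_dotProduct fun i => ?_
  rw [sub_dotProduct, h, sub_self]

theorem int_eq_of_forall_dotProduct (D : IsDualPair k n c) {v w : Fin 3 → ℤ}
    (h : ∀ i, v ⬝ᵥ k i = w ⬝ᵥ k i) : v = w := by
  refine latticeIncl_injective (D.eq_of_forall_dotProduct fun i => ?_)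
  rw [latticeIncl_dotProduct, latticeIncl_dotProduct, h]

theorem sum_inv_smul (D : IsDualPair k n c) : ∑ i, (c i : ℝ)⁻¹ • latticeIncl (k i) = 0 := by
  refine D.symm.eq_zero_of_forall_dotProduct fun j => ?_
  have hj := (D.cast_pos j).ne'
  have hs := D.sum_inv
  simp only [sum_dotProduct, smul_dotProduct, D.symm.pairing_real, smul_eq_mul, mul_sub, mul_one,
    Finset.sum_sub_distrib, hs, mul_ite, mul_zero, Finset.sum_ite_eq, Finset.mem_univ, if_true]
  rw [inv_mul_cancel₀ hj, sub_self]

theorem sum_inv_mul_dotProduct (D : IsDualPair k n c) (v : Fin 3 → ℝ) :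
    ∑ i, (c i : ℝ)⁻¹ * (v ⬝ᵥ latticeIncl (k i)) = 0 := by
  have := congrArg (fun w => v ⬝ᵥ w) D.sum_inv_smul
  simpa [dotProduct_sum, dotProduct_smul] using this

theorem eq_of_forall_ne (D : IsDualPair k n c) {v w : Fin 3 → ℝ} (j : Fin 4)
    (h : ∀ i, i ≠ j → v ⬝ᵥ latticeIncl (k i) = w ⬝ᵥ latticeIncl (k i)) : v = w := by
  refine D.eq_of_forall_dotProduct fun i => ?_
  by_cases hi : i = j
  · subst hi
    have hv := D.sum_inv_mul_dotProduct v
    have hw := D.sum_inv_mul_dotProduct w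
    rw [← Finset.add_sum_erase _ _ (Finset.mem_univ i)] at hv hw
    have he : ∑ l ∈ Finset.univ.erase i, (c l : ℝ)⁻¹ * (v ⬝ᵥ latticeIncl (k l)) =
        ∑ l ∈ Finset.univ.erase i, (c l : ℝ)⁻¹ * (w ⬝ᵥ latticeIncl (k l)) :=
      Finset.sum_congr rfl fun l hl => by rw [h l (Finset.ne_of_mem_erase hl)]
    have hc := inv_pos.mpr (D.cast_pos i)
    exact mul_left_cancel₀ hc.ne' (by linarith)
  · exact h i hi

theorem sum_barycentric (D : IsDualPair k n c) (v : Fin 3 → ℝ) :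
    ∑ j, (c j : ℝ)⁻¹ * (v ⬝ᵥ latticeIncl (k j) + 1) = 1 := by
  simp only [mul_add, mul_one, Finset.sum_add_distrib, D.sum_inv_mul_dotProduct, D.sum_inv,
    zero_add]

/-- The barycentric coordinates of `v` with respect to the `n j` are its normalized distances `(⟨v,
k j⟩ + 1) / c j` from the opposite facets. Their nonnegativity is exactly the system of inequalities
of the polar dual. -/
theorem sum_barycentric_smul (D : IsDualPair k n c) (v : Fin 3 → ℝ) :
    ∑ j, ((c j : ℝ)⁻¹ * (v ⬝ᵥ latticeIncl (k j) + 1)) • latticeIncl (n j) = v := by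
  refine D.eq_of_forall_dotProduct fun i => ?_
  have hi := (D.cast_pos i).ne'
  simp only [sum_dotProduct, smul_dotProduct, D.pairing_real, smul_eq_mul, mul_sub, mul_one,
    Finset.sum_sub_distrib, D.sum_barycentric, mul_ite, mul_zero, Finset.sum_ite_eq,
    Finset.mem_univ, if_true]
  field_simp
  ring

theorem polarDual_latticeSimplex (D : IsDualPair k n c) :
    polarDual (latticeSimplex k) = latticeSimplex n := by
  ext v
  rw [mem_polarDual_latticeSimplex]
  constructor
  · intro hv
    rw [← D.sum_barycentric_smul v]
    refine (convex_convexHull ℝ _).sum_mem (fun j _ => ?_) (D.sum_barycentric v)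
      fun j _ => latticeIncl_mem_latticeSimplex n j
    exact mul_nonneg (inv_nonneg.mpr (D.cast_pos j).le) (by linarith [hv j])
  · intro hv i
    have hsub : latticeSimplex n ⊆ {w | -1 ≤ latticeIncl (k i) ⬝ᵥ w} := by
      refine convexHull_min ?_ (convex_dotProduct_ge _ _)
      rintro _ ⟨j, rfl⟩
      simp only [Set.mem_ofPred_eq, D.symm.pairing_real]
      split_ifs
      · linarith [D.cast_pos i]
      · simp
    rw [dotProduct_comm]
    exact hsub hv

theorem mem_latticeSimplex (D : IsDualPair k n c) {v : Fin 3 → ℝ} :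
    v ∈ latticeSimplex n ↔ ∀ i, -1 ≤ v ⬝ᵥ latticeIncl (k i) := by
  rw [← D.polarDual_latticeSimplex, mem_polarDual_latticeSimplex]

end IsDualPair

/-- A point of the polar simplex that lies on three of the four facets, whose normals determine
points, is a vertex. -/
theorem mem_extremePoints_of_forall_ne {k : Fin 4 → Fin 3 → ℤ} {v : Fin 3 → ℝ} (j : Fin 4)
    (hmem : ∀ i, -1 ≤ v ⬝ᵥ latticeIncl (k i))
    (hv : ∀ i, i ≠ j → v ⬝ᵥ latticeIncl (k i) = -1)
    (huniq : ∀ w : Fin 3 → ℝ, (∀ i, i ≠ j → w ⬝ᵥ latticeIncl (k i) = -1) → w = v) :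
    v ∈ (polarDual (latticeSimplex k)).extremePoints ℝ := by
  rw [mem_extremePoints_iff_left]
  refine ⟨mem_polarDual_latticeSimplex.mpr hmem, fun x hx y hy hxy => ?_⟩
  rw [mem_polarDual_latticeSimplex] at hx hy
  obtain ⟨a, b, ha, hb, hab, rfl⟩ := hxy
  refine huniq x fun i hi => ?_
  have h := hv i hi
  rw [add_dotProduct, smul_dotProduct, smul_dotProduct, smul_eq_mul, smul_eq_mul] at h
  have h1 : 0 ≤ a * (x ⬝ᵥ latticeIncl (k i) + 1) := mul_nonneg ha.le (by linarith [hx i])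
  have h2 : 0 ≤ b * (y ⬝ᵥ latticeIncl (k i) + 1) := mul_nonneg hb.le (by linarith [hy i])
  have h3 : a * (x ⬝ᵥ latticeIncl (k i) + 1) = 0 := by linarith
  rcases mul_eq_zero.mp h3 with h4 | h4
  · exact absurd h4 ha.ne'
  · linarith

theorem IsDualPair.vertex_mem_extremePoints {k n : Fin 4 → Fin 3 → ℤ} {c : Fin 4 → ℤ}
    (D : IsDualPair k n c) (j : Fin 4) :
    latticeIncl (n j) ∈ (polarDual (latticeSimplex k)).extremePoints ℝ := by
  have hn : ∀ i, i ≠ j → latticeIncl (n j) ⬝ᵥ latticeIncl (k i) = -1 := fun i hi => by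
    simp [D.pairing_real, hi]
  refine mem_extremePoints_of_forall_ne j (fun i => ?_) hn fun w hw =>
    D.eq_of_forall_ne j fun i hi => by rw [hw i hi, hn i hi]
  exact D.mem_latticeSimplex.mp (latticeIncl_mem_latticeSimplex n j) i

/-! ### Edges -/

/-- The face of the simplex polar to `k` that is cut out by the vertices of `k` other than
`k i` and `k j`. -/
def edgeFace (k : Fin 4 → Fin 3 → ℤ) (i j : Fin 4) : Set (Fin 3 → ℝ) :=
  {v | (∀ a, -1 ≤ v ⬝ᵥ latticeIncl (k a)) ∧
    ∀ a, a ≠ i → a ≠ j → v ⬝ᵥ latticeIncl (k a) = -1}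

/-- The linear functional `v ↦ ⟨v, w⟩`. -/
noncomputable def pairingWith (w : Fin 3 → ℝ) : (Fin 3 → ℝ) →L[ℝ] ℝ :=
  ∑ t, w t • ContinuousLinearMap.proj (R := ℝ) (φ := fun _ : Fin 3 => ℝ) t

@[simp]
theorem pairingWith_apply (w v : Fin 3 → ℝ) : pairingWith w v = v ⬝ᵥ w := by
  simp [pairingWith, dotProduct, mul_comm]

/-- The equalities defining the face persist on its affine span. There the two remaining strict
inequalities describe an open neighbourhood of `v` inside the face. -/
theorem mem_intrinsicInterior_edgeFace {k : Fin 4 → Fin 3 → ℤ} {i j : Fin 4} {v : Fin 3 → ℝ}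
    (hv : v ∈ edgeFace k i j) (hi : -1 < v ⬝ᵥ latticeIncl (k i))
    (hj : -1 < v ⬝ᵥ latticeIncl (k j)) : v ∈ intrinsicInterior ℝ (edgeFace k i j) := by
  rw [mem_intrinsicInterior]
  refine ⟨⟨v, subset_affineSpan ℝ _ hv⟩, ?_, rfl⟩
  let V : Set (Fin 3 → ℝ) :=
    {w | -1 < pairingWith (latticeIncl (k i)) w} ∩ {w | -1 < pairingWith (latticeIncl (k j)) w}
  have hV : IsOpen V :=
    (isOpen_lt continuous_const (pairingWith _).continuous).inter
      (isOpen_lt continuous_const (pairingWith _).continuous)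
  have hspan : ∀ a, a ≠ i → a ≠ j → ∀ w ∈ affineSpan ℝ (edgeFace k i j),
      w ⬝ᵥ latticeIncl (k a) = -1 := by
    intro a hai haj w hw
    refine affineSpan_induction (p := fun w => w ⬝ᵥ latticeIncl (k a) = -1) hw
      (fun x hx => hx.2 a hai haj) fun r x y z hx hy hz => ?_
    simp only [vsub_eq_sub, vadd_eq_add, add_dotProduct, smul_dotProduct, sub_dotProduct, hx, hy,
      hz]
    simp
  refine mem_interior.mpr ⟨(↑) ⁻¹' V, ?_, hV.preimage continuous_subtype_val, ?_⟩
  · rintro ⟨w, hw⟩ ⟨hwi, hwj⟩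
    simp only [Set.mem_ofPred_eq, pairingWith_apply] at hwi hwj
    refine ⟨fun a => ?_, fun a hai haj => hspan a hai haj w hw⟩
    by_cases hai : a = i
    · subst hai; exact hwi.le
    by_cases haj : a = j
    · subst haj; exact hwj.le
    exact (hspan a hai haj w hw).ge
  · exact ⟨by simpa using hi, by simpa using hj⟩

namespace IsDualPair

variable {k n : Fin 4 → Fin 3 → ℤ} {c : Fin 4 → ℤ}

theorem injective (D : IsDualPair k n c) : Function.Injective n := by
  intro i j h
  by_contra hij
  have h1 := D.pairing i i
  have h2 := D.pairing i j
  rw [← h, h1] at h2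
  simp only [if_true, hij, if_false] at h2
  linarith [D.pos i]

theorem edgeFace_eq_segment (D : IsDualPair k n c) {i j : Fin 4} (hij : i ≠ j) :
    edgeFace k i j = segment ℝ (latticeIncl (n i)) (latticeIncl (n j)) := by
  ext v
  constructor
  · rintro ⟨hv, hv'⟩
    have hz : ∀ a, a ∉ ({i, j} : Finset (Fin 4)) → v ⬝ᵥ latticeIncl (k a) + 1 = 0 := by
      intro a ha
      simp only [Finset.mem_insert, Finset.mem_singleton, not_or] at ha
      rw [hv' a ha.1 ha.2]
      norm_num
    have h1 := D.sum_barycentric v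
    have h2 := D.sum_barycentric_smul v
    rw [← Finset.sum_subset (Finset.subset_univ {i, j})
      (fun a _ ha => by rw [hz a ha, mul_zero]), Finset.sum_pair hij] at h1
    rw [← Finset.sum_subset (Finset.subset_univ {i, j})
      (fun a _ ha => by rw [hz a ha, mul_zero, zero_smul]), Finset.sum_pair hij] at h2
    exact ⟨_, _, mul_nonneg (inv_nonneg.mpr (D.cast_pos i).le) (by linarith [hv i]),
      mul_nonneg (inv_nonneg.mpr (D.cast_pos j).le) (by linarith [hv j]), h1, h2⟩
  · intro hv
    have hsub := (convex_convexHull ℝ _).segment_subset (latticeIncl_mem_latticeSimplex n i)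
      (latticeIncl_mem_latticeSimplex n j) hv
    refine ⟨D.mem_latticeSimplex.mp hsub, fun a hai haj => ?_⟩
    obtain ⟨r, s, -, -, hrs, rfl⟩ := hv
    simp only [add_dotProduct, smul_dotProduct, D.pairing_real, hai, haj, if_false, smul_eq_mul]
    linarith

/-- The exposing functional is minus the sum of the pairings with the two other `k a`. Each pairing
is at least `-1`, and `n i` attains both minima, so a maximizer attains both as well. -/
theorem isEdge_edgeFace (D : IsDualPair k n c) {i j : Fin 4} (hij : i ≠ j) :
    IsEdge (polarDual (latticeSimplex k)) (edgeFace k i j) := by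
  constructor
  · intro _
    let S : Finset (Fin 4) := Finset.univ.filter fun a => a ≠ i ∧ a ≠ j
    let l := -∑ a ∈ S, pairingWith (latticeIncl (k a))
    have hl : ∀ v, l v = -∑ a ∈ S, v ⬝ᵥ latticeIncl (k a) := by
      intro v
      simp [l]
    refine ⟨l, ?_⟩
    ext v
    simp only [hl, neg_le_neg_iff, Set.mem_ofPred_eq, mem_polarDual_latticeSimplex, edgeFace]
    refine and_congr_right fun hv => ⟨fun h y hy => ?_, fun h a hai haj => ?_⟩
    · refine Finset.sum_le_sum fun a ha => ?_
      have ha' := (Finset.mem_filter.mp ha).2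
      rw [h a ha'.1 ha'.2]
      exact hy a
    · have h1 := h _ (D.mem_latticeSimplex.mp (latticeIncl_mem_latticeSimplex n i))
      have h2 : ∑ a ∈ S, latticeIncl (n i) ⬝ᵥ latticeIncl (k a) = ∑ a ∈ S, (-1 : ℝ) :=
        Finset.sum_congr rfl fun a ha => by
          simp [D.pairing_real, (Finset.mem_filter.mp ha).2.1]
      rw [h2] at h1
      have h3 := (Finset.sum_eq_sum_iff_of_le fun a _ => hv a).mp
        (le_antisymm (Finset.sum_le_sum fun a _ => hv a) h1)
      exact (h3 a (Finset.mem_filter.mpr ⟨Finset.mem_univ a, hai, haj⟩)).symm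
  · rw [D.edgeFace_eq_segment hij, vectorSpan_segment]
    refine finrank_span_singleton ?_
    rw [vsub_eq_sub, sub_ne_zero]
    exact fun h => hij (D.injective (latticeIncl_injective h)).symm

theorem dualFace_edgeFace (D : IsDualPair k n c) {i j a b : Fin 4} (hij : i ≠ j)
    (hab : ∀ x, (x ≠ a ∧ x ≠ b) ↔ (x = i ∨ x = j)) :
    dualFace (latticeSimplex k) (edgeFace k i j) = edgeFace n a b := by
  ext w
  rw [D.edgeFace_eq_segment hij]
  refine and_congr D.symm.mem_latticeSimplex ⟨fun h x hxa hxb => ?_, fun h v hv => ?_⟩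
  · rw [dotProduct_comm]
    rcases (hab x).mp ⟨hxa, hxb⟩ with rfl | rfl
    · exact h _ (left_mem_segment ℝ _ _)
    · exact h _ (right_mem_segment ℝ _ _)
  · have hi := (hab i).mpr (Or.inl rfl)
    have hj := (hab j).mpr (Or.inr rfl)
    obtain ⟨r, s, -, -, hrs, rfl⟩ := hv
    rw [add_dotProduct, smul_dotProduct, smul_dotProduct, dotProduct_comm, h i hi.1 hi.2,
      dotProduct_comm, h j hj.1 hj.2, smul_eq_mul, smul_eq_mul]
    linarith

/-- Multiplying by `h` keeps linear interpolation between the endpoints `n i` and `n j` within the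
integers. -/
theorem edgePoint_pairing (D : IsDualPair k n c) {i j : Fin 4} (hij : i ≠ j) {h : ℤ}
    {p : Fin 3 → ℤ} (hp : n j - n i = h • p) (t : ℤ) (a : Fin 4) :
    h * ((n i + t • p) ⬝ᵥ k a + 1) =
      if a = i then (h - t) * c i else if a = j then t * c j else 0 := by
  have h1 : h * (p ⬝ᵥ k a) = n j ⬝ᵥ k a - n i ⬝ᵥ k a := by
    rw [← sub_dotProduct, hp, smul_dotProduct, smul_eq_mul]
  rw [D.pairing, D.pairing] at h1
  rw [add_dotProduct, smul_dotProduct, smul_eq_mul, D.pairing]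
  by_cases hai : a = i
  · subst hai
    simp only [if_true, hij, if_false] at h1 ⊢
    linear_combination t * h1
  · by_cases haj : a = j
    · subst haj
      simp only [if_true, hai, if_false] at h1 ⊢
      linear_combination t * h1
    · simp only [hai, haj, if_false] at h1 ⊢
      linear_combination t * h1

theorem edgePoint_ne (D : IsDualPair k n c) {i j : Fin 4} (hij : i ≠ j) {h : ℤ}
    {p : Fin 3 → ℤ} (hp : n j - n i = h • p) {t : ℤ} (ht : 0 < t) (hth : t < h) (a : Fin 4) :
    (n i + t • p) ⬝ᵥ k a ≠ -1 ↔ a = i ∨ a = j := by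
  have h1 := D.edgePoint_pairing hij hp t a
  have hh : 0 < h := ht.trans hth
  constructor
  · intro hne
    by_contra hcon
    rw [not_or] at hcon
    rw [if_neg hcon.1, if_neg hcon.2] at h1
    rcases mul_eq_zero.mp h1 with h2 | h2
    · exact hh.ne' h2
    · exact hne (by linarith)
  · intro ha heq
    rw [heq, neg_add_cancel, mul_zero] at h1
    rcases ha with rfl | rfl
    · rw [if_pos rfl] at h1
      have := mul_pos (sub_pos.mpr hth) (D.pos a)
      exact this.ne h1
    · rw [if_neg hij.symm, if_pos rfl] at h1
      have := mul_pos ht (D.pos a)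
      exact this.ne h1

theorem edgePoint_ge (D : IsDualPair k n c) {i j : Fin 4} (hij : i ≠ j) {h : ℤ}
    {p : Fin 3 → ℤ} (hp : n j - n i = h • p) {t : ℤ} (ht : 0 < t) (hth : t < h) (a : Fin 4) :
    -1 ≤ (n i + t • p) ⬝ᵥ k a := by
  have h1 := D.edgePoint_pairing hij hp t a
  have hh : 0 < h := ht.trans hth
  have h2 : 0 ≤ h * ((n i + t • p) ⬝ᵥ k a + 1) := by
    rw [h1]
    split_ifs
    · exact (mul_pos (sub_pos.mpr hth) (D.pos i)).le
    · exact (mul_pos ht (D.pos j)).le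
    · exact le_rfl
  have := nonneg_of_mul_nonneg_right h2 hh
  linarith

theorem edgePoint_mem_intrinsicInterior (D : IsDualPair k n c) {i j : Fin 4} (hij : i ≠ j) {h : ℤ}
    {p : Fin 3 → ℤ} (hp : n j - n i = h • p) {t : ℤ} (ht : 0 < t) (hth : t < h) :
    latticeIncl (n i + t • p) ∈ intrinsicInterior ℝ (edgeFace k i j) := by
  have hge : ∀ a, (-1 : ℝ) ≤ latticeIncl (n i + t • p) ⬝ᵥ latticeIncl (k a) := fun a => by
    rw [latticeIncl_dotProduct]
    exact_mod_cast D.edgePoint_ge hij hp ht hth a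
  have hne : ∀ a, latticeIncl (n i + t • p) ⬝ᵥ latticeIncl (k a) ≠ -1 ↔ a = i ∨ a = j :=
    fun a => by
      rw [latticeIncl_dotProduct, ← D.edgePoint_ne hij hp ht hth a]
      norm_cast
  refine mem_intrinsicInterior_edgeFace ⟨hge, fun a hai haj => ?_⟩ ?_ ?_
  · by_contra hcon
    rcases (hne a).mp hcon with h1 | h1
    · exact hai h1
    · exact haj h1
  · exact lt_of_le_of_ne (hge i) ((hne i).mpr (Or.inl rfl)).symm
  · exact lt_of_le_of_ne (hge j) ((hne j).mpr (Or.inr rfl)).symm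

end IsDualPair

/-! ### A lower bound for the rank of `Pic_Δ` -/

theorem finite_latticeIncl_preimage {P : Set (Fin 3 → ℝ)} (hP : Bornology.IsBounded P) :
    (latticeIncl ⁻¹' P).Finite := by
  obtain ⟨R, hR⟩ := hP.exists_norm_le
  refine (Set.finite_Icc (fun _ : Fin 3 => -⌈R⌉) fun _ => ⌈R⌉).subset fun m hm => ?_
  have h : ∀ i, |m i| ≤ ⌈R⌉ := fun i => by
    have h1 : |((m i : ℤ) : ℝ)| ≤ R := (norm_le_pi_norm (latticeIncl m) i).trans (hR _ hm)
    exact_mod_cast h1.trans (Int.le_ceil R)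
  exact ⟨fun i => (abs_le.mp (h i)).1, fun i => (abs_le.mp (h i)).2⟩

theorem isBounded_latticeSimplex (k : Fin 4 → Fin 3 → ℤ) :
    Bornology.IsBounded (latticeSimplex k) :=
  isBounded_convexHull.mpr (Set.finite_range _).isBounded

theorem interiorLatticeCount_le {P G : Set (Fin 3 → ℝ)} (hP : Bornology.IsBounded P)
    (hG : G ⊆ P) : interiorLatticeCount G ≤ (latticeIncl ⁻¹' P).ncard :=
  Set.ncard_le_ncard (fun _ hm => hG (intrinsicInterior_subset hm))
    (finite_latticeIncl_preimage hP)

/-- Finiteness makes the function module the free group on the components; its rank is then the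
number of components. -/
theorem finite_divisorComponents {Δ : Set (Fin 3 → ℝ)} (hΔ : Bornology.IsBounded Δ)
    (hΔ' : Bornology.IsBounded (polarDual Δ)) : (divisorComponents Δ).Finite := by
  refine ((finite_latticeIncl_preimage hΔ').prod
    (Set.finite_Iic (latticeIncl ⁻¹' Δ).ncard)).subset ?_
  rintro ⟨v, s⟩ (⟨hv, hs⟩ | ⟨G, hG, hv, hs⟩)
  · exact ⟨hv.1, by simp only at hs; simp [hs]⟩
  · exact ⟨hG.1.subset (intrinsicInterior_subset hv),
      hs.trans (interiorLatticeCount_le hΔ fun w hw => hw.1)⟩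

/-- The characters form a group of rank 3, so their divisors span a subgroup of rank at most 3. -/
theorem card_le_rankPic_add_three {Δ : Set (Fin 3 → ℝ)} (hΔ : (divisorComponents Δ).Finite)
    {ι : Type*} [Fintype ι] {f : ι → (Fin 3 → ℤ) × ℕ} (hf : Function.Injective f)
    (hmem : ∀ i, f i ∈ divisorComponents Δ) : Fintype.card ι ≤ rankPic Δ + 3 := by
  have := hΔ.fintype
  have h1 := (LinearMap.range (characterDivisor Δ)).finrank_quotient_add_finrank
  have h2 := LinearMap.finrank_range_le (characterDivisor Δ)
  rw [Module.finrank_fintype_fun_eq_card] at h1 h2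
  have h3 : Fintype.card ι ≤ Fintype.card (divisorComponents Δ) :=
    Fintype.card_le_of_injective (fun i => ⟨f i, hmem i⟩) fun i j hij =>
      hf (congrArg Subtype.val hij)
  rw [Fintype.card_fin] at h2
  unfold rankPic PicLattice
  omega

theorem exists_complementary_pair : ∀ i j : Fin 4, i < j →
    ∃ a b : Fin 4, a < b ∧ ∀ x, (x ≠ a ∧ x ≠ b) ↔ (x = i ∨ x = j) := by
  decide

theorem pair_ext : ∀ i j i' j' : Fin 4, i < j → i' < j' →
    (∀ x, (x = i ∨ x = j) ↔ (x = i' ∨ x = j')) → i = i' ∧ j = j' := by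
  decide

/-! ### Counting components over the vertices and the edges. -/

namespace IsDualPair

variable {k n : Fin 4 → Fin 3 → ℤ} {c : Fin 4 → ℤ}

theorem le_interiorLatticeCount (D : IsDualPair k n c) {i j : Fin 4} (hij : i ≠ j) {h : ℕ}
    {p : Fin 3 → ℤ} (hp : n j - n i = (h : ℤ) • p) :
    h ≤ interiorLatticeCount (edgeFace k i j) + 1 := by
  have hp0 : p ≠ 0 := by
    rintro rfl
    rw [smul_zero, sub_eq_zero] at hp
    exact hij (D.injective hp).symm
  let f : ℕ → Fin 3 → ℤ := fun t => n i + (t : ℤ) • p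
  have hf : Function.Injective f := fun s t hst => by
    have := smul_left_injective ℤ hp0 (add_left_cancel hst)
    exact_mod_cast this
  -- Needed because `ncard` of an infinite set is 0.
  have hfin : {m : Fin 3 → ℤ | latticeIncl m ∈ intrinsicInterior ℝ (edgeFace k i j)}.Finite := by
    refine (finite_latticeIncl_preimage (isBounded_latticeSimplex n)).subset fun m hm => ?_
    exact D.mem_latticeSimplex.mpr (intrinsicInterior_subset hm).1
  have hsub : f '' Set.Ioo 0 h ⊆
      {m : Fin 3 → ℤ | latticeIncl m ∈ intrinsicInterior ℝ (edgeFace k i j)} := by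
    rintro _ ⟨t, ht, rfl⟩
    exact D.edgePoint_mem_intrinsicInterior hij hp (by exact_mod_cast ht.1)
      (by exact_mod_cast ht.2)
  have h1 := Set.ncard_le_ncard hsub hfin
  rw [Set.ncard_image_of_injective _ hf, ← Finset.coe_Ioo, Set.ncard_coe_finset,
    Nat.card_Ioo] at h1
  unfold interiorLatticeCount
  omega

/-- A lower bound for the rank of `Pic_Δ`, where `h` and `g` are divisors of the lattice lengths of
the edges of `Δ°` and of the respective dual edges of `Δ`. -/
theorem le_rankPic (D : IsDualPair k n c) (h g : Fin 4 → Fin 4 → ℕ)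
    (hh : ∀ i j, i < j → ∃ p, n j - n i = (h i j : ℤ) • p)
    (hg : ∀ i j a b, i < j → a < b → (∀ x, (x ≠ a ∧ x ≠ b) ↔ (x = i ∨ x = j)) →
      ∃ p, k b - k a = (g i j : ℤ) • p) :
    1 + ∑ p : {p : Fin 4 × Fin 4 // p.1 < p.2}, (h p.1.1 p.1.2 - 1) * g p.1.1 p.1.2 ≤
      rankPic (latticeSimplex k) := by
  choose! P hP using hh
  have hfin : (divisorComponents (latticeSimplex k)).Finite := by
    refine finite_divisorComponents (isBounded_latticeSimplex k) ?_
    rw [D.polarDual_latticeSimplex]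
    exact isBounded_latticeSimplex n
  let ι := Fin 4 ⊕ Σ p : {p : Fin 4 × Fin 4 // p.1 < p.2},
    Fin (h p.1.1 p.1.2 - 1) × Fin (g p.1.1 p.1.2)
  -- The shift by 1 makes the parameter run through `1, …, h - 1`, leaving out both endpoints.
  let pt : (Σ p : {p : Fin 4 × Fin 4 // p.1 < p.2},
      Fin (h p.1.1 p.1.2 - 1) × Fin (g p.1.1 p.1.2)) → Fin 3 → ℤ := fun e =>
    n e.1.1.1 + ((e.2.1 : ℕ) + 1 : ℤ) • P e.1.1.1 e.1.1.2
  let f : ι → (Fin 3 → ℤ) × ℕ := Sum.elim (fun j => (n j, 0)) fun e => (pt e, e.2.2)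
  have hpos : ∀ e : Σ p : {p : Fin 4 × Fin 4 // p.1 < p.2},
      Fin (h p.1.1 p.1.2 - 1) × Fin (g p.1.1 p.1.2), (0 : ℤ) < (e.2.1 : ℕ) + 1 := fun e => by
    positivity
  have hlt : ∀ e : Σ p : {p : Fin 4 × Fin 4 // p.1 < p.2},
      Fin (h p.1.1 p.1.2 - 1) × Fin (g p.1.1 p.1.2),
      ((e.2.1 : ℕ) + 1 : ℤ) < h e.1.1.1 e.1.1.2 := fun e => by
    have := e.2.1.isLt
    omega
  -- The pairings different from `-1` identify the face: two for an interior point of an edge, one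
  -- for a vertex. Points from different faces are therefore distinct.
  have hne : ∀ e a, pt e ⬝ᵥ k a ≠ -1 ↔ a = e.1.1.1 ∨ a = e.1.1.2 := fun e a =>
    D.edgePoint_ne e.1.2.ne (hP _ _ e.1.2) (hpos e) (hlt e) a
  have hnv : ∀ j a, n j ⬝ᵥ k a ≠ -1 ↔ a = j := fun j a => by
    rw [D.pairing]
    by_cases haj : a = j
    · simp [haj, (D.pos j).ne']
    · simp [haj]
  have hvert : ∀ j e, n j ≠ pt e := fun j e hje => by
    have h1 := fun a => (hnv j a).symm.trans (hje ▸ hne e a)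
    exact e.1.2.ne (((h1 _).mpr (Or.inl rfl)).trans ((h1 _).mpr (Or.inr rfl)).symm)
  have hinj : Function.Injective f := by
    rintro (j | e) (j' | e') hjj
    · exact congrArg Sum.inl (D.injective (congrArg Prod.fst hjj))
    · exact absurd (congrArg Prod.fst hjj) (hvert j e')
    · exact absurd (congrArg Prod.fst hjj).symm (hvert j' e)
    · have h1 : pt e = pt e' := congrArg Prod.fst hjj
      have h2 : (e.2.2 : ℕ) = e'.2.2 := congrArg Prod.snd hjj
      have h3 := pair_ext _ _ _ _ e.1.2 e'.1.2 fun x =>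
        (hne e x).symm.trans (h1 ▸ hne e' x)
      obtain ⟨⟨⟨i, j⟩, hij⟩, t, s⟩ := e
      obtain ⟨⟨⟨i', j'⟩, hij'⟩, t', s'⟩ := e'
      obtain ⟨rfl, rfl⟩ : i = i' ∧ j = j' := h3
      have hp0 : P i j ≠ 0 := by
        intro h0
        have h4 := hP i j hij
        rw [h0, smul_zero, sub_eq_zero] at h4
        exact hij.ne (D.injective h4).symm
      have h5 := smul_left_injective ℤ hp0 (add_left_cancel h1)
      have h6 : t = t' := Fin.ext (by exact_mod_cast add_right_cancel h5)
      have h7 : s = s' := Fin.ext h2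
      rw [h6, h7]
  have hmem : ∀ x, f x ∈ divisorComponents (latticeSimplex k) := by
    rintro (j | e)
    · exact Or.inl ⟨D.vertex_mem_extremePoints j, rfl⟩
    · refine Or.inr ⟨edgeFace k e.1.1.1 e.1.1.2, D.isEdge_edgeFace e.1.2.ne,
        D.edgePoint_mem_intrinsicInterior e.1.2.ne (hP _ _ e.1.2) (hpos e) (hlt e), ?_⟩
      obtain ⟨a, b, hab, hc⟩ := exists_complementary_pair _ _ e.1.2
      obtain ⟨p, hp⟩ := hg _ _ a b e.1.2 hab hc
      rw [D.dualFace_edgeFace e.1.2.ne hc]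
      have h1 := D.symm.le_interiorLatticeCount hab.ne hp
      have h2 := e.2.2.isLt
      change (e.2.2 : ℕ) ≤ _
      omega
  have hcard := card_le_rankPic_add_three hfin hinj hmem
  simp only [ι, Fintype.card_sum, Fintype.card_sigma, Fintype.card_prod, Fintype.card_fin] at hcard
  omega

end IsDualPair

/-! ### Reflexive simplices with given weights -/

/-- Such a `v` is orthogonal to the whole simplex, which nevertheless contains a small multiple `-t
• v` with `t > 0`; hence `⟨v, v⟩ ≤ 0`. -/
theorem eq_zero_of_forall_dotProduct_of_mem_interior {k : Fin 4 → Fin 3 → ℤ}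
    (h0 : 0 ∈ interior (latticeSimplex k)) {v : Fin 3 → ℝ}
    (hv : ∀ i, v ⬝ᵥ latticeIncl (k i) = 0) : v = 0 := by
  have hsub : latticeSimplex k ⊆ {w | 0 ≤ v ⬝ᵥ w} := by
    refine convexHull_min ?_ (convex_dotProduct_ge v 0)
    rintro _ ⟨i, rfl⟩
    exact (hv i).ge
  have hc : Filter.Tendsto (fun t : ℝ => (-t) • v) (nhdsWithin 0 (Set.Ioi 0)) (nhds 0) := by
    have : Continuous fun t : ℝ => (-t) • v := by fun_prop
    have h1 := this.tendsto 0
    rw [neg_zero, zero_smul] at h1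
    exact h1.mono_left nhdsWithin_le_nhds
  obtain ⟨t, ht, htpos⟩ :=
    ((hc.eventually (mem_interior_iff_mem_nhds.mp h0)).and self_mem_nhdsWithin).exists
  have h1 : 0 ≤ v ⬝ᵥ ((-t) • v) := hsub ht
  rw [dotProduct_smul, smul_eq_mul] at h1
  have h2 : 0 ≤ v ⬝ᵥ v := Finset.sum_nonneg fun i _ => mul_self_nonneg _
  have h3 : (0 : ℝ) < t := htpos
  exact dotProduct_self_eq_zero.mp (by nlinarith)

/-- The positive relation makes any three of the `k i` independent, so each dual vertex is the
solution of three linear equations. Pairing it with the relation gives `w j * c j = ∑ w`. -/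
theorem IsReflexive.exists_isDualPair {k : Fin 4 → Fin 3 → ℤ}
    (hk : IsReflexive (latticeSimplex k)) {w : Fin 4 → ℤ} (hw : ∀ i, 0 < w i)
    (hrel : ∑ i, w i • k i = 0) :
    ∃ n c, IsDualPair k n c ∧ ∀ j, w j * c j = ∑ i, w i := by
  obtain ⟨-, h0, S, -, hS⟩ := hk
  have hwR : ∀ i, (0 : ℝ) < w i := fun i => by exact_mod_cast hw i
  have hsum : ∀ v : Fin 3 → ℝ, ∑ i, (w i : ℝ) * (v ⬝ᵥ latticeIncl (k i)) = 0 := by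
    intro v
    have h1 : ∑ i, (w i : ℝ) • latticeIncl (k i) = 0 := by
      funext t
      have := congrFun hrel t
      simp only [Finset.sum_apply, Pi.smul_apply, smul_eq_mul, Pi.zero_apply, latticeIncl] at this ⊢
      exact_mod_cast this
    simpa [dotProduct_sum, dotProduct_smul] using congrArg (fun x => v ⬝ᵥ x) h1
  have huniq : ∀ j (v : Fin 3 → ℝ), (∀ i, i ≠ j → v ⬝ᵥ latticeIncl (k i) = 0) → v = 0 := by
    intro j v hv
    refine eq_zero_of_forall_dotProduct_of_mem_interior h0 fun i => ?_
    by_cases hi : i = j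
    · subst hi
      have h1 := hsum v
      rw [Finset.sum_eq_single i (fun l _ hl => by rw [hv l hl, mul_zero])
        (fun h => absurd (Finset.mem_univ i) h)] at h1
      exact (mul_eq_zero.mp h1).resolve_left (hwR i).ne'
    · exact hv i hi
  have hvert : ∀ j, ∃ v : Fin 3 → ℝ, ∀ i, i ≠ j → v ⬝ᵥ latticeIncl (k i) = -1 := by
    intro j
    let T := Matrix.mulVecLin (Matrix.of fun a : Fin 3 => latticeIncl (k (j.succAbove a)))
    have hT : ∀ v a, T v a = v ⬝ᵥ latticeIncl (k (j.succAbove a)) := fun v a => by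
      change latticeIncl _ ⬝ᵥ v = _
      exact dotProduct_comm _ _
    have hinj : Function.Injective T := by
      rw [injective_iff_map_eq_zero]
      intro v hv
      refine huniq j v fun i hi => ?_
      obtain ⟨a, rfl⟩ := Fin.exists_succAbove_eq hi
      rw [← hT, hv]
      rfl
    obtain ⟨v, hv⟩ := LinearMap.injective_iff_surjective.mp hinj fun _ => -1
    refine ⟨v, fun i hi => ?_⟩
    obtain ⟨a, rfl⟩ := Fin.exists_succAbove_eq hi
    rw [← hT, hv]
  choose v hv using hvert
  have hval : ∀ j, (w j : ℝ) * (v j ⬝ᵥ latticeIncl (k j) + 1) = ∑ i, (w i : ℝ) := by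
    intro j
    have h1 : ∑ i, (w i : ℝ) * (v j ⬝ᵥ latticeIncl (k i) + 1) = ∑ i, (w i : ℝ) := by
      simp only [mul_add, Finset.sum_add_distrib, hsum, zero_add, mul_one]
    rw [← h1, Finset.sum_eq_single j (fun l _ hl => by rw [hv j l hl]; ring)
      (fun h => absurd (Finset.mem_univ j) h)]
  have hpos : (0 : ℝ) < ∑ i, (w i : ℝ) := Finset.sum_pos (fun i _ => hwR i) Finset.univ_nonempty
  have hlat : ∀ j, ∃ m : Fin 3 → ℤ, latticeIncl m = v j := by
    intro j
    have hext : v j ∈ (polarDual (latticeSimplex k)).extremePoints ℝ := by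
      refine mem_extremePoints_of_forall_ne j (fun i => ?_) (hv j) fun x hx => ?_
      · by_cases hi : i = j
        · subst hi
          have := pos_of_mul_pos_right ((hval i).symm ▸ hpos) (hwR i).le
          linarith
        · exact (hv j i hi).ge
      · rw [← sub_eq_zero]
        refine huniq j _ fun i hi => ?_
        rw [sub_dotProduct, hx i hi, hv j i hi, sub_self]
    -- Reflexivity enters here: an extreme point of the hull of a set of lattice points is one of
    -- those points.
    rw [hS] at hext
    obtain ⟨m, -, hm⟩ := extremePoints_convexHull_subset hext
    exact ⟨m, hm⟩
  choose n hn using hlat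
  have hnk : ∀ j, w j * (n j ⬝ᵥ k j + 1) = ∑ i, w i := by
    intro j
    have := hval j
    rw [← hn j, latticeIncl_dotProduct] at this
    exact_mod_cast this
  have hposZ : 0 < ∑ i, w i := Finset.sum_pos (fun i _ => hw i) Finset.univ_nonempty
  refine ⟨n, fun j => n j ⬝ᵥ k j + 1, ⟨fun j => ?_, fun i j => ?_, ?_⟩, hnk⟩
  · exact pos_of_mul_pos_right ((hnk j).symm ▸ hposZ) (hw j).le
  · by_cases hi : i = j
    · simp [hi]
    · have := hv j i hi
      rw [← hn j, latticeIncl_dotProduct] at this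
      have h2 : n j ⬝ᵥ k i = -1 := by exact_mod_cast this
      simp [hi, h2]
  · have h1 : ∀ j, (((n j ⬝ᵥ k j + 1 : ℤ)) : ℝ)⁻¹ = w j / ∑ i, (w i : ℝ) := by
      intro j
      have h2 : (w j : ℝ) * ((n j ⬝ᵥ k j + 1 : ℤ) : ℝ) = ∑ i, (w i : ℝ) := by
        exact_mod_cast hnk j
      rw [← h2, div_mul_cancel_left₀ (hwR j).ne']
    simp only [h1]
    rw [← Finset.sum_div, div_self hpos.ne']

/-! ### Polynomials given by exponent matrices -/

theorem matrixPolynomial_eq_sum_monomial {n : ℕ} (A : Matrix (Fin n) (Fin n) ℕ) :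
    matrixPolynomial A = ∑ i, monomial (Finsupp.equivFunOnFinite.symm (A i)) (1 : ℂ) := by
  refine Finset.sum_congr rfl fun i _ => ?_
  rw [monomial_eq, Finsupp.prod_fintype _ _ (by simp)]
  simp

theorem mem_support_matrixPolynomial {n : ℕ} {A : Matrix (Fin n) (Fin n) ℕ} {m : Fin n →₀ ℕ} :
    m ∈ (matrixPolynomial A).support ↔ ∃ i, ⇑m = A i := by
  have h : ∀ i, Finsupp.equivFunOnFinite.symm (A i) = m ↔ ⇑m = A i := fun i => by
    rw [Equiv.symm_apply_eq, eq_comm]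
    rfl
  rw [matrixPolynomial_eq_sum_monomial, mem_support_iff, coeff_sum]
  simp only [coeff_monomial, h, Finset.sum_boole]
  -- The coefficient counts the rows equal to `m`, so nothing cancels in characteristic 0.
  rw [Nat.cast_ne_zero, Finset.card_ne_zero]
  simp [Finset.Nonempty]

theorem eval_pderiv_matrixPolynomial {n : ℕ} (A : Matrix (Fin n) (Fin n) ℕ) (p : Fin n → ℂ)
    (j : Fin n) : eval p (pderiv j (matrixPolynomial A)) =
      ∑ i, (A i j : ℂ) * ∏ l, p l ^ (A i l - if l = j then 1 else 0) := by
  rw [matrixPolynomial_eq_sum_monomial, map_sum, map_sum]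
  refine Finset.sum_congr rfl fun i _ => ?_
  rw [pderiv_monomial, eval_monomial, Finsupp.prod_fintype _ _ (by simp)]
  simp [Finsupp.single_apply, eq_comm]

/-- The consequences of the hypotheses of the theorem for the exponent matrix. -/
structure IsAdmissible (A : Matrix (Fin 4) (Fin 4) ℕ) : Prop where
  eq_zero_of_critical : ∀ p : Fin 4 → ℂ,
    (∀ j, ∑ i, (A i j : ℂ) * ∏ l, p l ^ (A i l - if l = j then 1 else 0) = 0) → p = 0
  exists_weights : ∃ q : Fin 4 → ℕ, (∀ j, 0 < q j) ∧ ∀ i, ∑ j, q j * A i j = ∑ j, q j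
  exists_simplex : ∃ k x : Fin 4 → Fin 3 → ℤ,
    (∀ i j, x j ⬝ᵥ k i = (A i j : ℤ) - 1) ∧
    (∀ w : Fin 4 → ℤ, (∀ j, ∑ i, w i * ((A i j : ℤ) - 1) = 0) → ∑ i, w i • k i = 0) ∧
    IsReflexive (latticeSimplex k) ∧
    rankPic (latticeSimplex k) + rankPic (polarDual (latticeSimplex k)) = 20

/-- The vertices `k i` are the `b`-coordinates of the rows of `A` minus `(1,1,1,1)`, and `x j` is
the `j`-th coordinate functional of `ℤ⁴` restricted to `M`. Independence of `b` carries relations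
among the shifted rows over to the `k i`. -/
theorem isAdmissible_of_matrixPolynomial {A : Matrix (Fin 4) (Fin 4) ℕ}
    {F : MvPolynomial (Fin 4) ℂ} {q : Fin 4 → ℕ} {b : Fin 3 → Fin 4 → ℤ}
    (hFA : F = matrixPolynomial A) (hF : IsInvertiblePolynomial F) (hq : IsCalabiYauWeight F q)
    (hb : IsExponentLatticeBasis F q b) (hrefl : IsReflexive (newtonPolytope F b))
    (hrank : rankPic (newtonPolytope F b) + rankPic (polarDual (newtonPolytope F b)) = 20) :
    IsAdmissible A := by
  subst hFA
  have hmem : ∀ i, Finsupp.equivFunOnFinite.symm (A i) ∈ (matrixPolynomial A).support := fun i =>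
    mem_support_matrixPolynomial.mpr ⟨i, rfl⟩
  have hk : ∀ i, ∃ k : Fin 3 → ℤ, ∀ j, ∑ l, k l * b l j = (A i j : ℤ) - 1 := by
    intro i
    obtain ⟨k, hk⟩ := (Submodule.mem_span_range_iff_exists_fun ℤ).mp (hb.2.2 _ (hmem i))
    refine ⟨k, fun j => ?_⟩
    simpa using congrFun hk j
  choose k hk using hk
  have hzero : ∀ x : Fin 3 → ℤ, (∀ j, ∑ l, x l * b l j = 0) → x = 0 := by
    intro x hx
    funext l
    refine Fintype.linearIndependent_iff.mp hb.1 x ?_ l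
    funext j
    simpa using hx j
  have hpoly : newtonPolytope (matrixPolynomial A) b = latticeSimplex k := by
    unfold newtonPolytope latticeSimplex
    congr 1
    ext y
    constructor
    · rintro ⟨x, ⟨m, hm, hx⟩, rfl⟩
      obtain ⟨i, hi⟩ := mem_support_matrixPolynomial.mp hm
      refine ⟨i, congrArg latticeIncl ?_⟩
      rw [← sub_eq_zero]
      refine hzero _ fun j => ?_
      simp only [Pi.sub_apply, sub_mul, Finset.sum_sub_distrib, hk, hx, hi, sub_self]
    · rintro ⟨i, rfl⟩
      exact ⟨k i, ⟨_, hmem i, hk i⟩, rfl⟩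
  rw [hpoly] at hrefl hrank
  obtain ⟨-, -, -, -, hcrit⟩ := hF
  refine ⟨fun p hp => ?_, ⟨q, hq.1, fun i => hq.2 _ (hmem i)⟩, k, fun j l => b l j, ?_, ?_, hrefl,
    hrank⟩
  · have : p ∈ {p : Fin 4 → ℂ | ∀ j, eval p (pderiv j (matrixPolynomial A)) = 0} := fun j => by
      rw [eval_pderiv_matrixPolynomial, hp j]
    rw [hcrit] at this
    exact this
  · intro i j
    rw [dotProduct_comm]
    exact hk i j
  · intro w hw
    refine hzero _ fun j => ?_
    rw [← hw j]
    simp only [← hk, Finset.sum_apply, Pi.smul_apply, smul_eq_mul, Finset.sum_mul, Finset.mul_sum]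
    rw [Finset.sum_comm]
    simp only [mul_assoc]

/-! ### Two obstructions: the `w`-axis must not be critical, and the dual weights must divide their
sum. -/

namespace IsAdmissible

variable {A : Matrix (Fin 4) (Fin 4) ℕ}

/-- If every monomial had degree at least 2 in `x, y, z`, each term of each partial derivative would
keep one of these variables, so `(1,0,0,0)` would be critical. -/
theorem exists_linear_row (hA : IsAdmissible A) : ∃ i, A i 1 + A i 2 + A i 3 ≤ 1 := by
  by_contra! hcon
  have h1 := hA.eq_zero_of_critical ![1, 0, 0, 0] fun j => by
    refine Finset.sum_eq_zero fun i _ => ?_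
    have h2 := hcon i
    obtain ⟨l, hl, hl'⟩ : ∃ l : Fin 4, (![1, 0, 0, 0] : Fin 4 → ℂ) l = 0 ∧
        A i l - (if l = j then 1 else 0) ≠ 0 := by
      by_contra! h3
      have e1 := h3 1 (by simp)
      have e2 := h3 2 (by simp)
      have e3 := h3 3 (by simp)
      fin_cases j <;> simp at e1 e2 e3 <;> omega
    rw [Finset.prod_eq_zero (Finset.mem_univ l) (by rw [hl, zero_pow hl']), mul_zero]
  have := congrFun h1 0
  simp at this

theorem dvd_sum_weights (hA : IsAdmissible A) {w : Fin 4 → ℤ} (hw : ∀ i, 0 < w i)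
    (hrel : ∀ j, ∑ i, w i * ((A i j : ℤ) - 1) = 0) (j : Fin 4) : w j ∣ ∑ i, w i := by
  obtain ⟨k, x, -, hk, hrefl, -⟩ := hA.exists_simplex
  obtain ⟨n, c, -, hc⟩ := hrefl.exists_isDualPair hw (hk w hrel)
  exact ⟨c j, (hc j).symm⟩

end IsAdmissible

/-! ### The rank bound for both polytopes -/

/-- The complement in `{0, 1, 2, 3}` of `{i, j}`, for `i < j`. -/
def complementaryPair (i j : Fin 4) : Fin 4 × Fin 4 :=
  (if i = 0 then if j = 1 then 2 else 1 else 0, if j = 3 then if i = 2 then 1 else 2 else 3)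

theorem complementaryPair_eq : ∀ i j a b : Fin 4, i < j → a < b →
    (∀ x, (x ≠ a ∧ x ≠ b) ↔ (x = i ∨ x = j)) → complementaryPair i j = (a, b) := by
  decide

/-- The lower bound for the rank of `Pic_Δ` in terms of the lengths of edges of `Δ°` and `Δ`. -/
def rankBound (h g : Fin 4 → Fin 4 → ℕ) : ℕ :=
  1 + ∑ p : {p : Fin 4 × Fin 4 // p.1 < p.2}, (h p.1.1 p.1.2 - 1) *
    g (complementaryPair p.1.1 p.1.2).1 (complementaryPair p.1.1 p.1.2).2

namespace IsDualPair

variable {k n : Fin 4 → Fin 3 → ℤ} {c : Fin 4 → ℤ}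

theorem rankBound_le (D : IsDualPair k n c) {h g : Fin 4 → Fin 4 → ℕ}
    (hh : ∀ i j, i < j → ∃ p, n j - n i = (h i j : ℤ) • p)
    (hg : ∀ i j, i < j → ∃ p, k j - k i = (g i j : ℤ) • p) :
    rankBound h g ≤ rankPic (latticeSimplex k) := by
  refine D.le_rankPic h (fun i j => g (complementaryPair i j).1 (complementaryPair i j).2) hh
    fun i j a b hij hab hc => ?_
  rw [complementaryPair_eq i j a b hij hab hc]
  exact hg a b hab

theorem rankBound_add_rankBound_le (D : IsDualPair k n c) {h g : Fin 4 → Fin 4 → ℕ}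
    (hh : ∀ i j, i < j → ∃ p, n j - n i = (h i j : ℤ) • p)
    (hg : ∀ i j, i < j → ∃ p, k j - k i = (g i j : ℤ) • p) :
    rankBound h g + rankBound g h ≤
      rankPic (latticeSimplex k) + rankPic (polarDual (latticeSimplex k)) := by
  rw [D.polarDual_latticeSimplex]
  exact add_le_add (D.rankBound_le hh hg) (D.symm.rankBound_le hg hh)

/-- Divisibility of `n j - n i` by `h` is certified by an integral combination of vectors with
known pairings. -/
theorem exists_sub_eq_smul (D : IsDualPair k n c) {x : Fin 4 → Fin 3 → ℤ}
    {A : Matrix (Fin 4) (Fin 4) ℕ} (hx : ∀ i j, x j ⬝ᵥ k i = (A i j : ℤ) - 1)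
    (α β : Fin 4 → ℤ) {i j : Fin 4} {h : ℤ}
    (heq : ∀ a, (if a = j then c j else 0) - (if a = i then c i else 0) =
      h * (∑ l, α l * ((if a = l then c l else 0) - 1) + ∑ l, β l * ((A a l : ℤ) - 1))) :
    ∃ p, n j - n i = h • p := by
  refine ⟨∑ l, α l • n l + ∑ l, β l • x l, D.int_eq_of_forall_dotProduct fun a => ?_⟩
  have h1 := heq a
  simp only [sub_dotProduct, smul_dotProduct, add_dotProduct, sum_dotProduct, D.pairing, hx,
    smul_eq_mul]
  linarith

end IsDualPair

theorem forall_lt_of_pairs {P : Fin 4 → Fin 4 → Prop} (h01 : P 0 1) (h02 : P 0 2) (h03 : P 0 3)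
    (h12 : P 1 2) (h13 : P 1 3) (h23 : P 2 3) : ∀ i j, i < j → P i j := by
  intro i j hij
  fin_cases i <;> fin_cases j <;> first | assumption | exact absurd hij (by decide)

/-! ### The three reflexive simplices -/

theorem not_isAdmissible_fermat_J30 : ¬ IsAdmissible
    ![![18, 0, 0, 0], ![0, 6, 0, 0], ![0, 1, 3, 0], ![0, 0, 0, 2]] := by
  intro hA
  obtain ⟨k, x, hx, hk, hrefl, hrank⟩ := hA.exists_simplex
  -- These weights span the left kernel of `A` minus the all-ones matrix: they are the Calabi–Yau
  -- weights of the transposed polynomial. They give `c j = 18 / w j`.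
  have hrel := hk ![1, 2, 6, 9] (by decide)
  obtain ⟨n, c, D, hc⟩ := hrefl.exists_isDualPair (by decide) hrel
  obtain rfl : c = ![18, 9, 3, 2] := by
    funext j
    have := hc j
    simp only [Fin.sum_univ_four] at this
    fin_cases j <;> simp at this ⊢ <;> omega
  simp only [Fin.sum_univ_four] at hrel
  have hbound := D.rankBound_add_rankBound_le
    -- Only entries above the diagonal count. `h` concerns the edges of `Δ°`, `g` those of `Δ`.
    (h := ![![0, 9, 3, 2], ![0, 0, 3, 1], ![0, 0, 0, 1], ![0, 0, 0, 0]])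
    (g := ![![0, 3, 1, 2], ![0, 0, 1, 1], ![0, 0, 0, 1], ![0, 0, 0, 0]])
    (forall_lt_of_pairs
      (D.exists_sub_eq_smul hx ![0, 1, 1, 1] ![0, -1, 0, 0] (by decide))
      (D.exists_sub_eq_smul hx ![0, 0, 2, 3] ![0, 1, 0, 0] (by decide))
      (D.exists_sub_eq_smul hx ![0, 1, 3, 5] ![0, 0, 0, 0] (by decide))
      (D.exists_sub_eq_smul hx ![0, -1, 0, 0] ![0, 1, 0, 0] (by decide))
      ⟨_, (one_smul ℤ _).symm⟩
      ⟨_, (one_smul ℤ _).symm⟩)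
    (forall_lt_of_pairs
      -- Eliminating `k 0` by the relation gives `k 1 - k 0 = 3 • k 1 + 6 • k 2 + 9 • k 3`; the
      -- divisor 2 of `k 3 - k 0` arises likewise.
      ⟨k 1 + (2 : ℤ) • k 2 + (3 : ℤ) • k 3, by
        simp at hrel ⊢
        linear_combination (exp := 1) (-1 : ℤ) • hrel⟩
      ⟨_, (one_smul ℤ _).symm⟩
      ⟨k 1 + (3 : ℤ) • k 2 + (5 : ℤ) • k 3, by
        simp at hrel ⊢
        linear_combination (exp := 1) (-1 : ℤ) • hrel⟩
      ⟨_, (one_smul ℤ _).symm⟩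
      ⟨_, (one_smul ℤ _).symm⟩
      ⟨_, (one_smul ℤ _).symm⟩)
  rw [hrank] at hbound
  -- The two bounds are 16 and 6.
  exact absurd hbound (by decide)

theorem not_isAdmissible_chain_W18 : ¬ IsAdmissible
    ![![8, 1, 0, 0], ![0, 7, 0, 0], ![0, 0, 2, 1], ![0, 0, 0, 2]] := by
  intro hA
  obtain ⟨k, x, hx, hk, hrefl, hrank⟩ := hA.exists_simplex
  have hrel := hk ![1, 1, 4, 2] (by decide)
  obtain ⟨n, c, D, hc⟩ := hrefl.exists_isDualPair (by decide) hrel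
  obtain rfl : c = ![8, 8, 2, 4] := by
    funext j
    have := hc j
    simp only [Fin.sum_univ_four] at this
    fin_cases j <;> simp at this ⊢ <;> omega
  simp only [Fin.sum_univ_four] at hrel
  have hbound := D.rankBound_add_rankBound_le
    (h := ![![0, 8, 2, 4], ![0, 0, 2, 4], ![0, 0, 0, 2], ![0, 0, 0, 0]])
    (g := ![![0, 2, 1, 1], ![0, 0, 1, 1], ![0, 0, 0, 1], ![0, 0, 0, 0]])
    (forall_lt_of_pairs
      (D.exists_sub_eq_smul hx ![0, 1, 0, 0] ![0, -1, 0, 0] (by decide))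
      (D.exists_sub_eq_smul hx ![-1, -2, 0, 0] ![0, 2, 0, -1] (by decide))
      (D.exists_sub_eq_smul hx ![0, 1, 0, 0] ![0, -1, 0, 1] (by decide))
      (D.exists_sub_eq_smul hx ![0, 1, 0, 0] ![0, -2, 0, -1] (by decide))
      (D.exists_sub_eq_smul hx ![0, -1, 0, 0] ![0, 1, 0, 1] (by decide))
      (D.exists_sub_eq_smul hx ![0, 0, -1, 0] ![0, 0, 0, 1] (by decide)))
    (forall_lt_of_pairs
      ⟨k 1 + (2 : ℤ) • k 2 + k 3, by
        simp at hrel ⊢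
        linear_combination (exp := 1) (-1 : ℤ) • hrel⟩
      ⟨_, (one_smul ℤ _).symm⟩
      ⟨_, (one_smul ℤ _).symm⟩
      ⟨_, (one_smul ℤ _).symm⟩
      ⟨_, (one_smul ℤ _).symm⟩
      ⟨_, (one_smul ℤ _).symm⟩)
  rw [hrank] at hbound
  -- The two bounds are 18 and 3.
  exact absurd hbound (by decide)

theorem not_isAdmissible_chain_U16 : ¬ IsAdmissible
    ![![6, 1, 0, 0], ![0, 5, 0, 0], ![0, 0, 2, 1], ![0, 0, 1, 2]] := by
  intro hA
  obtain ⟨k, x, hx, hk, hrefl, hrank⟩ := hA.exists_simplex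
  have hrel := hk ![1, 1, 2, 2] (by decide)
  obtain ⟨n, c, D, hc⟩ := hrefl.exists_isDualPair (by decide) hrel
  obtain rfl : c = ![6, 6, 3, 3] := by
    funext j
    have := hc j
    simp only [Fin.sum_univ_four] at this
    fin_cases j <;> simp at this ⊢ <;> omega
  simp only [Fin.sum_univ_four] at hrel
  have hbound := D.rankBound_add_rankBound_le
    (h := ![![0, 6, 3, 3], ![0, 0, 3, 3], ![0, 0, 0, 3], ![0, 0, 0, 0]])
    (g := ![![0, 2, 1, 1], ![0, 0, 1, 1], ![0, 0, 0, 1], ![0, 0, 0, 0]])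
    (forall_lt_of_pairs
      (D.exists_sub_eq_smul hx ![0, 1, 0, 0] ![0, -1, 0, 0] (by decide))
      (D.exists_sub_eq_smul hx ![0, 1, 0, 0] ![0, -1, 1, 0] (by decide))
      (D.exists_sub_eq_smul hx ![0, 1, 0, 0] ![0, -1, 0, 1] (by decide))
      (D.exists_sub_eq_smul hx ![0, -1, 0, 0] ![0, 1, 1, 0] (by decide))
      (D.exists_sub_eq_smul hx ![0, -1, 0, 0] ![0, 1, 0, 1] (by decide))
      (D.exists_sub_eq_smul hx ![0, 0, -1, 0] ![0, 0, 1, 0] (by decide)))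
    (forall_lt_of_pairs
      ⟨k 1 + k 2 + k 3, by
        simp at hrel ⊢
        linear_combination (exp := 1) (-1 : ℤ) • hrel⟩
      ⟨_, (one_smul ℤ _).symm⟩
      ⟨_, (one_smul ℤ _).symm⟩
      ⟨_, (one_smul ℤ _).symm⟩
      ⟨_, (one_smul ℤ _).symm⟩
      ⟨_, (one_smul ℤ _).symm⟩)
  rw [hrank] at hbound
  -- The two bounds are 18 and 4.
  exact absurd hbound (by decide)

/-! ### The five families -/

theorem complex_I_pow_six : Complex.I ^ 6 = -1 := by
  rw [show 6 = 2 * 3 from rfl, pow_mul, Complex.I_sq]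
  norm_num

/-- The exponents of the defining equations as polynomials in `w, x, y, z`. -/
def BimodalPair.exponents : BimodalPair → Fin 3 → Fin 4 → ℕ
  | .Z13_J30 => ![![0, 6, 0, 0], ![0, 1, 3, 0], ![0, 0, 0, 2]]
  | .X20_S17 => ![![0, 6, 1, 0], ![0, 0, 2, 1], ![0, 0, 0, 2]]
  | .W18_W18 => ![![0, 7, 0, 0], ![0, 0, 2, 1], ![0, 0, 0, 2]]
  | .W17_S10 => ![![0, 5, 1, 0], ![0, 0, 2, 1], ![0, 0, 0, 2]]
  | .U16_U16 => ![![0, 5, 0, 0], ![0, 0, 2, 1], ![0, 0, 1, 2]]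

theorem BimodalPair.rename_definingEquation_add (B : BimodalPair) (e : Fin 4 →₀ ℕ) :
    rename Fin.succ B.definingEquation + monomial e 1 =
      matrixPolynomial (Matrix.of (Matrix.vecCons (⇑e) B.exponents)) := by
  cases B <;>
  · simp [BimodalPair.definingEquation, BimodalPair.exponents, matrixPolynomial,
      Fin.sum_univ_four, Fin.prod_univ_four, monomial_eq, Finsupp.prod_fintype]
    ring

/-- The additional monomial is of the form `w ^ a` or `w ^ a * x_j`. -/
theorem IsAdmissible.exists_linear {e : Fin 4 → ℕ} {r : Fin 3 → Fin 4 → ℕ}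
    (hA : IsAdmissible (Matrix.of (Matrix.vecCons e r)))
    (hr : ∀ i, 2 ≤ r i 1 + r i 2 + r i 3) :
    (e 1 = 0 ∧ e 2 = 0 ∧ e 3 = 0) ∨ (e 1 = 1 ∧ e 2 = 0 ∧ e 3 = 0) ∨
      (e 1 = 0 ∧ e 2 = 1 ∧ e 3 = 0) ∨ (e 1 = 0 ∧ e 2 = 0 ∧ e 3 = 1) := by
  obtain ⟨i, hi⟩ := hA.exists_linear_row
  have : e 1 + e 2 + e 3 ≤ 1 := by
    refine Fin.cases (fun h => h) (fun a h => ?_) i hi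
    have h' : r a 1 + r a 2 + r a 3 ≤ 1 := h
    exact absurd h' (by have := hr a; omega)
  omega

theorem IsAdmissible.of_eq {e : Fin 4 → ℕ} {r : Fin 3 → Fin 4 → ℕ}
    (hA : IsAdmissible (Matrix.of (Matrix.vecCons e r))) {a b c d : ℕ} (h0 : e 0 = a)
    (h : e 1 = b ∧ e 2 = c ∧ e 3 = d) :
    IsAdmissible (Matrix.of (Matrix.vecCons ![a, b, c, d] r)) := by
  have : e = ![a, b, c, d] := by
    funext j
    fin_cases j
    exacts [h0, h.1, h.2.1, h.2.2]
  rwa [← this]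

theorem IsAdmissible.false_of_critical {A : Matrix (Fin 4) (Fin 4) ℕ} (hA : IsAdmissible A)
    {p : Fin 4 → ℂ} (h0 : p 0 = 1)
    (hp : ∀ j, ∑ i, (A i j : ℂ) * ∏ l, p l ^ (A i l - if l = j then 1 else 0) = 0) : False := by
  rw [hA.eq_zero_of_critical p hp] at h0
  simp at h0

theorem not_isAdmissible_Z13_J30 (e : Fin 4 → ℕ) :
    ¬ IsAdmissible (Matrix.of (Matrix.vecCons e BimodalPair.Z13_J30.exponents)) := by
  intro hA
  obtain ⟨q, hq, hrow⟩ := hA.exists_weights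
  -- The three monomials of `f` and the Calabi–Yau condition force `q = s • (1, 3, 5, 9)` and degree
  -- `18 * s`.
  have hweight : e 0 + 3 * e 1 + 5 * e 2 + 9 * e 3 = 18 := by
    have r0 := hrow 0
    have r1 := hrow 1
    have r2 := hrow 2
    have r3 := hrow 3
    simp [BimodalPair.exponents, Fin.sum_univ_four] at r0 r1 r2 r3
    have q0 := hq 0
    obtain ⟨s, hs⟩ : ∃ s, q 0 = s := ⟨_, rfl⟩
    have e1 : q 1 = 3 * s := by omega
    have e2 : q 2 = 5 * s := by omega
    have e3 : q 3 = 9 * s := by omega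
    rw [hs, e1, e2, e3] at r0
    have : s * (e 0 + 3 * e 1 + 5 * e 2 + 9 * e 3) = s * 18 := by
      linarith
    exact Nat.eq_of_mul_eq_mul_left (by omega) this
  obtain h | h | h | h := hA.exists_linear (by decide)
  · replace hA := hA.of_eq (show e 0 = 18 by omega) h
    exact not_isAdmissible_fermat_J30 hA
  · replace hA := hA.of_eq (show e 0 = 15 by omega) h
    -- Both `w ^ 15 * x` and `x * y ^ 3` are linear in `x`; the point is a zero of `w ^ 15 + y ^ 3`.
    refine hA.false_of_critical (p := ![1, 0, -1, 0]) rfl fun j => ?_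
    fin_cases j <;> simp [BimodalPair.exponents, Fin.sum_univ_four, Fin.prod_univ_four]
    norm_num
  · replace hA := hA.of_eq (show e 0 = 13 by omega) h
    exact absurd (hA.dvd_sum_weights (w := ![2, 3, 8, 13]) (by decide) (by decide) 1)
      (by decide)
  · replace hA := hA.of_eq (show e 0 = 9 by omega) h
    exact absurd (hA.dvd_sum_weights (w := ![1, 1, 3, 4]) (by decide) (by decide) 3)
      (by decide)

theorem not_isAdmissible_X20_S17 (e : Fin 4 → ℕ) :
    ¬ IsAdmissible (Matrix.of (Matrix.vecCons e BimodalPair.X20_S17.exponents)) := by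
  intro hA
  obtain ⟨q, hq, hrow⟩ := hA.exists_weights
  have hweight : e 0 + e 1 + 2 * e 2 + 4 * e 3 = 8 := by
    have r0 := hrow 0
    have r1 := hrow 1
    have r2 := hrow 2
    have r3 := hrow 3
    simp [BimodalPair.exponents, Fin.sum_univ_four] at r0 r1 r2 r3
    have q0 := hq 0
    obtain ⟨s, hs⟩ : ∃ s, q 0 = s := ⟨_, rfl⟩
    have e1 : q 1 = s := by omega
    have e2 : q 2 = 2 * s := by omega
    have e3 : q 3 = 4 * s := by omega
    rw [hs, e1, e2, e3] at r0
    have : s * (e 0 + e 1 + 2 * e 2 + 4 * e 3) = s * 8 := by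
      linarith
    exact Nat.eq_of_mul_eq_mul_left (by omega) this
  obtain h | h | h | h := hA.exists_linear (by decide)
  · replace hA := hA.of_eq (show e 0 = 8 by omega) h
    exact absurd (hA.dvd_sum_weights (w := ![3, 4, 10, 7]) (by decide) (by decide) 2)
      (by decide)
  · replace hA := hA.of_eq (show e 0 = 7 by omega) h
    exact absurd (hA.dvd_sum_weights (w := ![1, 1, 3, 2]) (by decide) (by decide) 2)
      (by decide)
  · replace hA := hA.of_eq (show e 0 = 6 by omega) h
    -- Here `w ^ 6 * y` and `x ^ 6 * y` share the factor `y`, and `I ^ 6 = -1` makes `w ^ 6 + x ^ 6`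
    -- vanish.
    refine hA.false_of_critical (p := ![1, Complex.I, 0, 0]) rfl fun j => ?_
    fin_cases j <;> simp [BimodalPair.exponents, Fin.sum_univ_four, Fin.prod_univ_four,
      complex_I_pow_six]
  · replace hA := hA.of_eq (show e 0 = 4 by omega) h
    refine hA.false_of_critical (p := ![1, 0, Complex.I, 0]) rfl fun j => ?_
    fin_cases j <;> simp [BimodalPair.exponents, Fin.sum_univ_four, Fin.prod_univ_four]

theorem not_isAdmissible_W18_W18 (e : Fin 4 → ℕ) :
    ¬ IsAdmissible (Matrix.of (Matrix.vecCons e BimodalPair.W18_W18.exponents)) := by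
  intro hA
  obtain ⟨q, hq, hrow⟩ := hA.exists_weights
  have hweight : 3 * e 0 + 4 * e 1 + 7 * e 2 + 14 * e 3 = 28 := by
    have r0 := hrow 0
    have r1 := hrow 1
    have r2 := hrow 2
    have r3 := hrow 3
    simp [BimodalPair.exponents, Fin.sum_univ_four] at r0 r1 r2 r3
    have q0 := hq 0
    obtain ⟨s, hs⟩ : ∃ s, q 0 = 3 * s := ⟨q 0 / 3, by omega⟩
    have e1 : q 1 = 4 * s := by omega
    have e2 : q 2 = 7 * s := by omega
    have e3 : q 3 = 14 * s := by omega
    rw [hs, e1, e2, e3] at r0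
    have : s * (3 * e 0 + 4 * e 1 + 7 * e 2 + 14 * e 3) = s * 28 := by
      linarith
    exact Nat.eq_of_mul_eq_mul_left (by omega) this
  obtain h | h | h | h := hA.exists_linear (by decide)
  -- The exponent of `w` would be `28 / 3`.
  · omega
  · replace hA := hA.of_eq (show e 0 = 8 by omega) h
    exact not_isAdmissible_chain_W18 hA
  · replace hA := hA.of_eq (show e 0 = 7 by omega) h
    exact absurd (hA.dvd_sum_weights (w := ![1, 1, 3, 2]) (by decide) (by decide) 2)
      (by decide)
  · omega

theorem not_isAdmissible_W17_S10 (e : Fin 4 → ℕ) :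
    ¬ IsAdmissible (Matrix.of (Matrix.vecCons e BimodalPair.W17_S10.exponents)) := by
  intro hA
  obtain ⟨q, hq, hrow⟩ := hA.exists_weights
  have hweight : 2 * e 0 + 3 * e 1 + 5 * e 2 + 10 * e 3 = 20 := by
    have r0 := hrow 0
    have r1 := hrow 1
    have r2 := hrow 2
    have r3 := hrow 3
    simp [BimodalPair.exponents, Fin.sum_univ_four] at r0 r1 r2 r3
    have q0 := hq 0
    obtain ⟨s, hs⟩ : ∃ s, q 0 = 2 * s := ⟨q 0 / 2, by omega⟩
    have e1 : q 1 = 3 * s := by omega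
    have e2 : q 2 = 5 * s := by omega
    have e3 : q 3 = 10 * s := by omega
    rw [hs, e1, e2, e3] at r0
    have : s * (2 * e 0 + 3 * e 1 + 5 * e 2 + 10 * e 3) = s * 20 := by
      linarith
    exact Nat.eq_of_mul_eq_mul_left (by omega) this
  obtain h | h | h | h := hA.exists_linear (by decide)
  · replace hA := hA.of_eq (show e 0 = 10 by omega) h
    exact absurd (hA.dvd_sum_weights (w := ![1, 2, 4, 3]) (by decide) (by decide) 2)
      (by decide)
  -- Parity: `2 * e 0` would be 17, and 15 in the next case.
  · omega
  · omega
  · replace hA := hA.of_eq (show e 0 = 5 by omega) h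
    refine hA.false_of_critical (p := ![1, 0, Complex.I, 0]) rfl fun j => ?_
    fin_cases j <;> simp [BimodalPair.exponents, Fin.sum_univ_four, Fin.prod_univ_four]

theorem not_isAdmissible_U16_U16 (e : Fin 4 → ℕ) :
    ¬ IsAdmissible (Matrix.of (Matrix.vecCons e BimodalPair.U16_U16.exponents)) := by
  intro hA
  obtain ⟨q, hq, hrow⟩ := hA.exists_weights
  have hweight : 2 * e 0 + 3 * e 1 + 5 * e 2 + 5 * e 3 = 15 := by
    have r0 := hrow 0
    have r1 := hrow 1
    have r2 := hrow 2
    have r3 := hrow 3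
    simp [BimodalPair.exponents, Fin.sum_univ_four] at r0 r1 r2 r3
    have q0 := hq 0
    obtain ⟨s, hs⟩ : ∃ s, q 0 = 2 * s := ⟨q 0 / 2, by omega⟩
    have e1 : q 1 = 3 * s := by omega
    have e2 : q 2 = 5 * s := by omega
    have e3 : q 3 = 5 * s := by omega
    rw [hs, e1, e2, e3] at r0
    have : s * (2 * e 0 + 3 * e 1 + 5 * e 2 + 5 * e 3) = s * 15 := by
      linarith
    exact Nat.eq_of_mul_eq_mul_left (by omega) this
  obtain h | h | h | h := hA.exists_linear (by decide)
  · omega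
  · replace hA := hA.of_eq (show e 0 = 6 by omega) h
    exact not_isAdmissible_chain_U16 hA
  · replace hA := hA.of_eq (show e 0 = 5 by omega) h
    -- The factor `y` is common to `w ^ 5 * y` and `y * z ^ 2`, and `w ^ 5 + z ^ 2` vanishes; the
    -- next case exchanges `y` and `z`.
    refine hA.false_of_critical (p := ![1, 0, 0, Complex.I]) rfl fun j => ?_
    fin_cases j <;> simp [BimodalPair.exponents, Fin.sum_univ_four, Fin.prod_univ_four]
  · replace hA := hA.of_eq (show e 0 = 5 by omega) h
    refine hA.false_of_critical (p := ![1, 0, Complex.I, 0]) rfl fun j => ?_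
    fin_cases j <;> simp [BimodalPair.exponents, Fin.sum_univ_four, Fin.prod_univ_four]

theorem BimodalPair.not_isAdmissible (B : BimodalPair) (e : Fin 4 → ℕ) :
    ¬ IsAdmissible (Matrix.of (Matrix.vecCons e B.exponents)) := by
  cases B
  · exact not_isAdmissible_Z13_J30 e
  · exact not_isAdmissible_X20_S17 e
  · exact not_isAdmissible_W18_W18 e
  · exact not_isAdmissible_W17_S10 e
  · exact not_isAdmissible_U16_U16 e

theorem theoremA (B : BimodalPair) :
    ¬ ∃ (F : MvPolynomial (Fin 4) ℂ) (q : Fin 4 → ℕ) (b : Fin 3 → Fin 4 → ℤ),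
      IsInvertibleDeformation F B.definingEquation ∧
      IsCalabiYauWeight F q ∧
      IsExponentLatticeBasis F q b ∧
      IsReflexive (newtonPolytope F b) ∧
      rankPic (newtonPolytope F b) + rankPic (polarDual (newtonPolytope F b)) = 20 := by
  rintro ⟨F, q, b, ⟨hF, e, -, he⟩, hq, hb, hrefl, hrank⟩
  rw [B.rename_definingEquation_add] at he
  exact B.not_isAdmissible e (isAdmissible_of_matrixPolynomial he hF hq hb hrefl hrank)
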